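/- Let $V=\mathbb{R}^n$ with a norm $\|\cdot\|$ (i.e. any finite-dimensional real normed space of dimension $n$), and put $S=\{v:\|v\|=1\}$. A closed set $C\subset V$ is a cone of rank $k\ge 1$ (a $k$-cone) if $lv\in C$ for all $v\in C$, $l\in\mathbb{R}$, and $k$ is the maximal dimension of a linear subspace contained in $C$; it is $k$-solid if $W\setminus\{0\}\subset\operatorname{Int}C$ for some $k$-dimensional subspace $W$. Write $x\sim y$ if $x-y\in C$ and $x\approx y$ if $x-y\in\operatorname{Int}C$. Let $\Phi:\mathbb{R}\times V\to V$ be a flow which is $C^{1,\alpha}$, $\alpha\in(0,1]$ (a $C^1$ map with locally $\alpha$-Hölder derivative), and strongly monotone with respect to a $k$-solid $k$-cone $C$: $x\sim y$ implies $\Phi_t(x)\sim\Phi_t(y)$ for $t\ge0$, and $x\sim y$, $x\neq y$ imply $\Phi_t(x)\approx\Phi_t(y)$ for $t>0$. Assume moreover $D_x\Phi_t(C\setminus\{0\})\subset\operatorname{Int}C$ for all $x\in V$, $t>0$. Let $O(x)=\{\Phi_t(x):t\ge0\}$ and $\omega(x)=\bigcap_{s\ge0}\overline{\{\Phi_t(x):t\ge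 s\}}$. Let $Q$ be the set of points $x$ whose orbit is pseudo-ordered: $O(x)\ne\{x\}$ and $O(x)$ contains two distinct points $a,b$ with $a\sim b$. Let $D\subset V$ be an open set which is $\omega$-compact, i.e. $O(x)$ is bounded for each $x\in D$ and $\bigcup_{x\in D}\omega(x)$ is bounded. For a compact invariant set $K$, a $k$-exponential separation along $K$ associated with $C$ consists of families of subspaces $(E_z)_{z\in K}$ of dimension $k$ and $(F_z)_{z\in K}$ of dimension $n-k$, continuous in $z$ for the gap metric, such that for all $z\in K$: $V=E_z\oplus F_z$; $D_z\Phi_tE_z=E_{\Phi_t(z)}$ and $D_z\Phi_tF_z\subset F_{\Phi_t(z)}$ for $t>0$; $E_z\subset\operatorname{Int}C\cup\{0\}$ and $F_z\cap C=\{0\}$; and, for some constants $M>0$ and $0<\gamma<1$ independent of $z$, $\|D_z\Phi_tw\|\le M\gamma^t\|D_z\Phi_tv\|$ for all $w\in F_z\cap S$, $v\in E_z\cap S$, $t\ge0$. The corresponding $k$-Lyapunov exponent of $z\in K$ is $$\lambda_{kz}=\limsup_{t\to+\infty}\frac1t\log\ \inf_{v\in E_z\cap S}\|D_z\Phi_tv\|.$$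 Theorem. Let $x\in D$. Then a $k$-exponential separation along $\omega(x)$ associated with $C$ exists, so that the exponents $\lambda_{kz}$, $z\in\omega(x)$, are available; and for every such separation, if $\lambda_{kz}>0$ for every $z\in\omega(x)$, then $x\in\overline{Q}$. -/

import Mathlib

open Set Filter Topology
open scoped NNReal

noncomputable section

namespace ConeFlow

variable {V : Type*} [NormedAddCommGroup V] [NormedSpace ℝ V]

/-! ### Cones of rank `k` -/

/-- `C` is a cone of rank `k ≥ 1`: a closed set, invariant under multiplication by all real scalars,
such that `k` is the maximal dimension of a linear subspace contained in `C`. -/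
structure IsCone (k : ℕ) (C : Set V) : Prop where
  one_le : 1 ≤ k
  isClosed : IsClosed C
  smul_mem : ∀ v ∈ C, ∀ l : ℝ, l • v ∈ C
  isGreatest : IsGreatest
    {d : ℕ | ∃ W : Submodule ℝ V, (W : Set V) ⊆ C ∧ Module.finrank ℝ W = d} k

/-- `C` is `k`-solid: some `k`-dimensional subspace lies in `Int C ∪ {0}`. -/
def IsSolid (k : ℕ) (C : Set V) : Prop :=
  ∃ W : Submodule ℝ V, Module.finrank ℝ W = k ∧ (W : Set V) \ {0} ⊆ interior C

/-- `x ∼ y`: the points `x` and `y` are ordered with respect to `C`. -/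
def Ordered (C : Set V) (x y : V) : Prop := x - y ∈ C

/-- `x ≈ y`: the points `x` and `y` are strongly ordered with respect to `C`. -/
def StronglyOrdered (C : Set V) (x y : V) : Prop := x - y ∈ interior C

/-! ### Flows -/

/-- The spatial derivative `D_x Φ_t`. -/
def spatialDeriv (Φ : Flow ℝ V) (t : ℝ) (x : V) : V →L[ℝ] V :=
  fderiv ℝ (fun y : V => Φ t y) x

/-- The flow, as a map `ℝ × V → V`, is `C¹` with locally `α`-Hölder derivative. -/
structure IsC1Holder (Φ : Flow ℝ V) (α : ℝ≥0) : Prop where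
  pos : 0 < α
  le_one : α ≤ 1
  contDiff : ContDiff ℝ 1 (fun p : ℝ × V => Φ p.1 p.2)
  holder : ∀ p : ℝ × V, ∃ U ∈ 𝓝 p, ∃ c : ℝ≥0,
    HolderOnWith c α (fderiv ℝ (fun q : ℝ × V => Φ q.1 q.2)) U

/-- The flow is strongly monotone with respect to the `k`-solid cone `C`. -/
structure IsStronglyMonotone (Φ : Flow ℝ V) (k : ℕ) (C : Set V) : Prop where
  isCone : IsCone k C
  isSolid : IsSolid k C
  monotone : ∀ x y : V, Ordered C x y → ∀ t : ℝ, 0 ≤ t → Ordered C (Φ t x) (Φ t y)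
  strong : ∀ x y : V, x ≠ y → Ordered C x y →
    ∀ t : ℝ, 0 < t → StronglyOrdered C (Φ t x) (Φ t y)

/-- The standing assumption on the flow: it is `C^{1,α}`-smooth, strongly monotone with respect to
the `k`-cone `C`, and `D_x Φ_t` maps `C \ {0}` into `Int C` for all `x` and all `t > 0`. -/
structure FWW (Φ : Flow ℝ V) (α : ℝ≥0) (k : ℕ) (C : Set V) : Prop where
  smooth : IsC1Holder Φ α
  stronglyMonotone : IsStronglyMonotone Φ k C
  deriv_mem : ∀ (x : V) (t : ℝ), 0 < t → ∀ v ∈ C, v ≠ 0 → spatialDeriv Φ t x v ∈ interior C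

/-- The (forward) orbit `O(x) = {Φ_t(x) : t ≥ 0}`. -/
def orbit (Φ : Flow ℝ V) (x : V) : Set V := (fun t : ℝ => Φ t x) '' Ici 0

/-- The `ω`-limit set of the point `x`: the intersection over `s` of the closures of
`{Φ_t(x) : t ≥ s}`. -/
def omega (Φ : Flow ℝ V) (x : V) : Set V := omegaLimit atTop (fun t y => Φ t y) {x}

/-- `D` is `ω`-compact: all orbits starting in `D` are bounded, and the union of their `ω`-limit
sets is bounded. -/
def IsOmegaCompact (Φ : Flow ℝ V) (D : Set V) : Prop :=
  (∀ x ∈ D, Bornology.IsBounded (orbit Φ x)) ∧ Bornology.IsBounded (⋃ x ∈ D, omega Φ x)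

/-- The orbit of `x` is pseudo-ordered: it is nontrivial and contains two distinct ordered
points. -/
def IsPseudoOrdered (Φ : Flow ℝ V) (C : Set V) (x : V) : Prop :=
  orbit Φ x ≠ {x} ∧ ∃ a ∈ orbit Φ x, ∃ b ∈ orbit Φ x, a ≠ b ∧ Ordered C a b

/-- The set `Q` of points with pseudo-ordered orbit. -/
def pseudoOrderedSet (Φ : Flow ℝ V) (C : Set V) : Set V := {x | IsPseudoOrdered Φ C x}

/-! ### Exponential separation and Lyapunov exponents -/

/-- The gap distance of two subspaces: the Hausdorff distance of their unit spheres, that is, the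
maximum of `sup_{v ∈ L₁ ∩ S} inf_{u ∈ L₂ ∩ S} ‖v - u‖` and of the same quantity with `L₁` and
`L₂` exchanged. -/
def gap (L₁ L₂ : Submodule ℝ V) : ℝ :=
  Metric.hausdorffDist ((L₁ : Set V) ∩ Metric.sphere 0 1) ((L₂ : Set V) ∩ Metric.sphere 0 1)

/-- `K × (Y_z)` is a `d`-dimensional continuous bundle: all fibres over `K` have dimension `d`, and
`z ↦ Y_z` is continuous on `K` for the gap distance. Values of `Y` outside `K` play no role. -/
structure IsContinuousBundle (d : ℕ) (K : Set V) (Y : V → Submodule ℝ V) : Prop where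
  finrank_eq : ∀ z ∈ K, Module.finrank ℝ (Y z) = d
  continuous : ∀ z ∈ K, Tendsto (fun y => gap (Y y) (Y z)) (𝓝[K] z) (𝓝 0)

/-- `V = E_z ⊕ F_z`, `z ∈ K`, is a `k`-exponential separation of `(Φ_t, DΦ_t)` along the compact
invariant set `K`, associated with the cone `C`. -/
structure IsExpSeparation (Φ : Flow ℝ V) (k : ℕ) (C K : Set V) (E F : V → Submodule ℝ V) :
    Prop where
  bundle_E : IsContinuousBundle k K E
  bundle_F : IsContinuousBundle (Module.finrank ℝ V - k) K F
  isCompl : ∀ z ∈ K, IsCompl (E z) (F z)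
  map_E : ∀ z ∈ K, ∀ t : ℝ, 0 < t →
    (E z).map (spatialDeriv Φ t z : V →ₗ[ℝ] V) = E (Φ t z)
  map_F : ∀ z ∈ K, ∀ t : ℝ, 0 < t →
    (F z).map (spatialDeriv Φ t z : V →ₗ[ℝ] V) ≤ F (Φ t z)
  separation : ∃ M γ : ℝ, 0 < M ∧ 0 < γ ∧ γ < 1 ∧
    ∀ z ∈ K, ∀ w ∈ F z, ‖w‖ = 1 → ∀ v ∈ E z, ‖v‖ = 1 → ∀ t : ℝ, 0 ≤ t →
      ‖spatialDeriv Φ t z w‖ ≤ M * γ ^ t * ‖spatialDeriv Φ t z v‖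
  E_subset : ∀ z ∈ K, (E z : Set V) ⊆ interior C ∪ {0}
  F_inter : ∀ z ∈ K, (F z : Set V) ∩ C = {0}

/-- The infimum norm `m(T|_L) = inf {‖T v‖ : v ∈ L, ‖v‖ = 1}`. -/
def infNorm (T : V →L[ℝ] V) (L : Submodule ℝ V) : ℝ :=
  sInf ((fun v => ‖T v‖) '' ((L : Set V) ∩ Metric.sphere 0 1))

/-- The `k`-Lyapunov exponent at `z` for the bundle `E`, the upper limit of
`log m(D_z Φ_t |_{E_z}) / t` as `t → +∞`, taken in the extended reals. -/
def lyapunovExponent (Φ : Flow ℝ V) (E : V → Submodule ℝ V) (z : V) : EReal :=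
  limsup (fun t : ℝ => ((Real.log (infNorm (spatialDeriv Φ t z) (E z)) / t : ℝ) : EReal)) atTop

end ConeFlow

end

/-!
Vectors of the linearized flow that never enter `C \ {0}` form the fibres `F`, and vectors that stay
in `C` in backward time form the fibres `E`. Strong positivity and compactness give a uniform angle
between `F` and `C`, hence an exponential domination of `F` by `C`. If a sum of two vectors of `F`
entered `C`, it would be negligible with respect to itself, so `F` is a subspace; the same argument
in backward time applies to `E`. A complement of `F` is eventually mapped into `C`, so `F` has
codimension `k`, and a complement `E` arises as a limit of images of `k`-dimensional
subspaces of `C`.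

If all exponents on `ω(x)` are positive, `DΦ_τ` expands the cone by a factor `3` for suitable times
`τ`, so near `ω(x)` the flow doubles the distance of ordered points. A point `y ∼ x` close to `x` is
therefore driven to a distance `δ` from the orbit of `x` at arbitrarily late times `t`, when
`Φ_t y - Φ_t x` is uniformly deep inside `C`. As the relatively compact orbit of `x` is shadowed by
finitely many points `Φ_s y`, some difference `Φ_t y - Φ_s y` lies in `C`, so `y ∈ Q`.
-/

namespace ConeFlow

theorem eventually_forall_add_mem_of_isCompact {X V : Type*} [TopologicalSpace X]
    [TopologicalSpace V] [AddZeroClass V] [ContinuousAdd V] {S : Set X} (hS : IsCompact S)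
    {f : X → V} (hf : Continuous f) {U : Set V} (hU : IsOpen U) (hfU : MapsTo f S U) :
    ∀ᶠ u in 𝓝 (0 : V), ∀ p ∈ S, f p + u ∈ U :=
  hS.eventually_forall_of_forall_eventually fun p hp =>
    ((hf.comp continuous_snd).add continuous_fst).continuousAt.eventually_mem
      (hU.mem_nhds (by simpa using hfU hp))

section Cone

variable {V : Type*} [NormedAddCommGroup V] [NormedSpace ℝ V] {k : ℕ} {C : Set V}

theorem IsCone.exists_finrank_eq (hC : IsCone k C) :
    ∃ W : Submodule ℝ V, (W : Set V) ⊆ C ∧ Module.finrank ℝ W = k :=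
  hC.isGreatest.1

theorem IsCone.finrank_le (hC : IsCone k C) {W : Submodule ℝ V} (hW : (W : Set V) ⊆ C) :
    Module.finrank ℝ W ≤ k :=
  hC.isGreatest.2 ⟨W, hW, rfl⟩

theorem IsCone.zero_mem (hC : IsCone k C) : (0 : V) ∈ C :=
  let ⟨W, hW, _⟩ := hC.exists_finrank_eq
  hW W.zero_mem

theorem IsCone.exists_ne_zero (hC : IsCone k C) : ∃ v ∈ C, v ≠ 0 := by
  obtain ⟨W, hWC, hWk⟩ := hC.exists_finrank_eq
  have hW : W ≠ ⊥ := by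
    rintro rfl
    exact absurd hC.one_le (by simp [← hWk])
  obtain ⟨v, hv, hv0⟩ := W.exists_mem_ne_zero_of_ne_bot hW
  exact ⟨v, hWC hv, hv0⟩

theorem IsCone.mem_of_inv_smul_mem (hC : IsCone k C) {v : V} {l : ℝ} (hl : l ≠ 0)
    (hv : l⁻¹ • v ∈ C) : v ∈ C := by
  simpa only [smul_inv_smul₀ hl] using hC.smul_mem _ hv l

end Cone

section Cocycle

variable {X V : Type*} [NormedAddCommGroup V] [NormedSpace ℝ V] {A : ℝ → X → V →L[ℝ] V} {k : ℕ}
  {C : Set V} {z : X}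

/-- The family `A` is strongly positive with respect to the cone `C`: for positive times it sends
`C \ {0}` into `Int C`. -/
def IsStronglyPositive (A : ℝ → X → V →L[ℝ] V) (C : Set V) : Prop :=
  ∀ (z : X) (t : ℝ), 0 < t → ∀ v ∈ C, v ≠ 0 → A t z v ∈ interior C

/-- The fibre at `z` of the stable bundle `F`: the vectors which never enter `C \ {0}` in forward
time. -/
def stableSet (A : ℝ → X → V →L[ℝ] V) (C : Set V) (z : X) : Set V :=
  {w | ∀ t : ℝ, 0 ≤ t → A t z w ∈ C → w = 0}

/-- The fibre at `z` of the unstable bundle `E`: the vectors which stay in `C` in backward time. -/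
def unstableSet (A : ℝ → X → V →L[ℝ] V) (C : Set V) (z : X) : Set V :=
  {v | ∀ t : ℝ, 0 ≤ t → A (-t) z v ∈ C}

theorem smul_mem_unstableSet (hC : IsCone k C) {v : V} (l : ℝ) (hv : v ∈ unstableSet A C z) :
    l • v ∈ unstableSet A C z := fun t ht => by
  simpa only [map_smul] using hC.smul_mem _ (hv t ht) l

theorem smul_mem_stableSet (hC : IsCone k C) {w : V} (l : ℝ) (hw : w ∈ stableSet A C z) :
    l • w ∈ stableSet A C z := by
  intro t ht hlw
  rcases eq_or_ne l 0 with rfl | hl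
  · exact zero_smul _ _
  · rw [hw t ht (hC.mem_of_inv_smul_mem (inv_ne_zero hl) (by rwa [inv_inv, ← map_smul])),
      smul_zero]

variable [TopologicalSpace X] {Φ : Flow ℝ X}

/-- A continuous linear cocycle over the flow `Φ`: the abstract form of the linearized flow
`DΦ_t` along an invariant set. -/
structure IsLinearCocycle (Φ : Flow ℝ X) (A : ℝ → X → V →L[ℝ] V) : Prop where
  continuous : Continuous fun p : ℝ × X => A p.1 p.2
  map_zero_apply : ∀ (z : X) (v : V), A 0 z v = v
  map_add_apply : ∀ (s t : ℝ) (z : X) (v : V), A (s + t) z v = A s (Φ t z) (A t z v)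

namespace IsLinearCocycle

variable (hA : IsLinearCocycle Φ A)
include hA

theorem neg_apply_apply (t : ℝ) (z : X) (v : V) : A (-t) (Φ t z) (A t z v) = v := by
  rw [← hA.map_add_apply, neg_add_cancel, hA.map_zero_apply]

theorem apply_neg_apply (t : ℝ) (z : X) (v : V) : A t (Φ (-t) z) (A (-t) z v) = v := by
  simpa only [neg_neg] using hA.neg_apply_apply (-t) z v

theorem injective (t : ℝ) (z : X) : Function.Injective (A t z) :=
  Function.LeftInverse.injective (hA.neg_apply_apply t z)

theorem apply_ne_zero (t : ℝ) (z : X) {v : V} (hv : v ≠ 0) : A t z v ≠ 0 :=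
  (map_ne_zero_iff _ (hA.injective t z)).2 hv

theorem finrank_map (t : ℝ) (z : X) (W : Submodule ℝ V) :
    Module.finrank ℝ (W.map (A t z : V →ₗ[ℝ] V)) = Module.finrank ℝ W :=
  (Submodule.equivMapOfInjective _ (hA.injective t z) W).finrank_eq.symm

theorem continuous_apply (t : ℝ) : Continuous fun p : X × V => A t p.1 p.2 :=
  (hA.continuous.comp (continuous_const.prodMk continuous_fst)).clm_apply continuous_snd

theorem exists_norm_apply_le [CompactSpace X] (T : ℝ) :
    ∃ L, 0 < L ∧ ∀ t, |t| ≤ T → ∀ z v, ‖A t z v‖ ≤ L * ‖v‖ := by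
  obtain ⟨L, hL⟩ := ((isCompact_Icc (a := -T) (b := T)).prod
    (isCompact_univ (X := X))).exists_bound_of_continuousOn hA.continuous.continuousOn
  refine ⟨max L 1, by positivity, fun t ht z v => (A t z).le_of_opNorm_le ?_ v⟩
  exact (hL (t, z) ⟨abs_le.1 ht, mem_univ z⟩).trans (le_max_left _ _)

end IsLinearCocycle

theorem IsStronglyPositive.apply_mem (hpos : IsStronglyPositive A C) (hA : IsLinearCocycle Φ A)
    (hC : IsCone k C) {t : ℝ} (ht : 0 ≤ t) {v : V} (hv : v ∈ C) : A t z v ∈ C := by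
  rcases eq_or_ne v 0 with rfl | hv0
  · simpa only [map_zero] using hC.zero_mem
  rcases ht.eq_or_lt with rfl | ht
  · simpa only [hA.map_zero_apply] using hv
  · exact interior_subset (hpos z t ht v hv hv0)

section StronglyPositive

variable (hA : IsLinearCocycle Φ A) (hpos : IsStronglyPositive A C) (hC : IsCone k C)

include hA in
theorem eq_zero_of_mem_stableSet {w : V} (hw : w ∈ stableSet A C z) (hwC : w ∈ C) : w = 0 :=
  hw 0 le_rfl (by rwa [hA.map_zero_apply])

include hA in
theorem disjoint_of_subset_stableSet {W F : Submodule ℝ V} (hW : (W : Set V) ⊆ C)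
    (hF : (F : Set V) ⊆ stableSet A C z) : Disjoint W F :=
  Submodule.disjoint_def.2 fun _ hv hvF => eq_zero_of_mem_stableSet hA (hF hvF) (hW hv)

include hA in
theorem unstableSet_subset : unstableSet A C z ⊆ C := fun v hv => by
  simpa only [neg_zero, hA.map_zero_apply] using hv 0 le_rfl

include hA hpos in
theorem unstableSet_subset_interior : unstableSet A C z ⊆ interior C ∪ {0} := by
  intro v hv
  rcases eq_or_ne v 0 with rfl | hv0
  · exact Or.inr rfl
  · left
    simpa only [hA.apply_neg_apply] using
      hpos (Φ (-1) z) 1 one_pos _ (hv 1 zero_le_one) (hA.apply_ne_zero _ z hv0)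

include hA hpos in
theorem isClosed_stableSet : IsClosed {p : X × V | p.2 ∈ stableSet A C p.1} := by
  rw [← isOpen_compl_iff, isOpen_iff_eventually]
  rintro ⟨z, w⟩ hp
  simp only [mem_compl_iff, mem_ofPred_eq, stableSet, not_forall] at hp ⊢
  obtain ⟨t, ht, hwC, hw⟩ := hp
  have hint : A (1 + t) z w ∈ interior C := by
    rw [hA.map_add_apply]
    exact hpos _ _ one_pos _ hwC (hA.apply_ne_zero t z hw)
  filter_upwards [(hA.continuous_apply (1 + t)).continuousAt.eventually_mem
      (isOpen_interior.mem_nhds hint),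
    continuous_snd.continuousAt.eventually_mem (isOpen_ne.mem_nhds hw)] with p hp hp'
  exact ⟨1 + t, by positivity, interior_subset hp, hp'⟩

include hA hC in
theorem isClosed_unstableSet : IsClosed {p : X × V | p.2 ∈ unstableSet A C p.1} := by
  simp only [unstableSet, mem_iInter, ofPred_forall]
  exact isClosed_iInter fun t => isClosed_iInter fun _ =>
    hC.isClosed.preimage (hA.continuous_apply (-t))

include hA hpos hC

theorem apply_mem_stableSet {w : V} (t : ℝ) (hw : w ∈ stableSet A C z) :
    A t z w ∈ stableSet A C (Φ t z) := by
  intro s hs hsw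
  rw [← hA.map_add_apply] at hsw
  have hmem : A (|t| + (s + t)) z w ∈ C := by
    rw [hA.map_add_apply]
    exact hpos.apply_mem hA hC (abs_nonneg t) hsw
  rw [hw _ (by linarith [neg_abs_le t]) hmem, map_zero]

theorem apply_mem_unstableSet {v : V} (t : ℝ) (hv : v ∈ unstableSet A C z) :
    A t z v ∈ unstableSet A C (Φ t z) := by
  intro s _
  rw [← hA.map_add_apply]
  rcases le_total 0 (-s + t) with h | h
  · exact hpos.apply_mem hA hC h (unstableSet_subset hA hv)
  · simpa only [neg_neg] using hv (-(-s + t)) (by linarith)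

theorem eventually_forall_apply_mem {S : Set V} (hS : IsCompact S)
    (hdisj : Disjoint S (stableSet A C z)) : ∀ᶠ t in atTop, ∀ u ∈ S, A t z u ∈ C := by
  refine hS.induction_on (p := fun S => ∀ᶠ t in atTop, ∀ u ∈ S, A t z u ∈ C) (by simp)
    (fun _ _ hsub h => h.mono fun t ht u hu => ht u (hsub hu))
    (fun _ _ h₁ h₂ => (h₁.and h₂).mono fun t ht u hu => hu.elim (ht.1 u) (ht.2 u))
    fun u hu => ?_
  have hus := disjoint_left.1 hdisj hu
  simp only [stableSet, mem_ofPred_eq, not_forall] at hus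
  obtain ⟨s, _, hsu, hu0⟩ := hus
  have hint : A (1 + s) z u ∈ interior C := by
    rw [hA.map_add_apply]
    exact hpos _ 1 one_pos _ hsu (hA.apply_ne_zero s z hu0)
  refine ⟨A (1 + s) z ⁻¹' interior C, mem_nhdsWithin_of_mem_nhds
    ((isOpen_interior.preimage (A (1 + s) z).continuous).mem_nhds hint), ?_⟩
  filter_upwards [eventually_ge_atTop (1 + s)] with t ht v hv
  rw [← sub_add_cancel t (1 + s), hA.map_add_apply]
  exact hpos.apply_mem hA hC (sub_nonneg.2 ht) (interior_subset hv)

variable [FiniteDimensional ℝ V] [CompactSpace X]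

theorem exists_mul_norm_le_norm_sub :
    ∃ c, 0 < c ∧ ∀ z, ∀ u ∈ C, ∀ w ∈ stableSet A C z, c * ‖w‖ ≤ ‖u - w‖ := by
  have hS : IsCompact ((univ ×ˢ Metric.sphere (0 : V) 1) ∩ {p : X × V | p.2 ∈ stableSet A C p.1}) :=
    (isCompact_univ.prod (isCompact_sphere 0 1)).inter_right (isClosed_stableSet hA hpos)
  obtain ⟨c, hc, hcS⟩ := hS.exists_forall_le' (f := fun p : X × V => Metric.infDist p.2 C) (a := 0)
    ((Metric.continuous_infDist_pt C).comp continuous_snd).continuousOn (by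
      rintro ⟨z, w⟩ ⟨⟨-, hw⟩, hwF⟩
      refine (hC.isClosed.notMem_iff_infDist_pos ⟨0, hC.zero_mem⟩).1 fun hwC => ?_
      exact Metric.ne_of_mem_sphere hw one_ne_zero (eq_zero_of_mem_stableSet hA hwF hwC))
  refine ⟨c, hc, fun z u hu w hw => ?_⟩
  rcases eq_or_ne w 0 with rfl | hw0
  · simp
  have hunit : c ≤ ‖‖w‖⁻¹ • u - ‖w‖⁻¹ • w‖ := calc
    c ≤ Metric.infDist (‖w‖⁻¹ • w) C := hcS (z, ‖w‖⁻¹ • w)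
      ⟨⟨mem_univ z, by simp [norm_smul, hw0]⟩, smul_mem_stableSet hC _ hw⟩
    _ ≤ dist (‖w‖⁻¹ • w) (‖w‖⁻¹ • u) := Metric.infDist_le_dist_of_mem (hC.smul_mem u hu _)
    _ = ‖‖w‖⁻¹ • u - ‖w‖⁻¹ • w‖ := by rw [dist_comm, dist_eq_norm]
  rwa [← smul_sub, norm_smul, norm_inv, norm_norm, inv_mul_eq_div,
    le_div_iff₀ (norm_pos_iff.2 hw0)] at hunit

theorem exists_forall_apply_one_add_mem :
    ∃ δ, 0 < δ ∧ ∀ z, ∀ v ∈ C, ∀ u, ‖u‖ ≤ δ * ‖v‖ → A 1 z v + u ∈ C := by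
  have hS : IsCompact ((univ : Set X) ×ˢ (C ∩ Metric.sphere (0 : V) 1)) :=
    isCompact_univ.prod ((isCompact_sphere 0 1).inter_left hC.isClosed)
  obtain ⟨δ, hδ, hδS⟩ := Metric.nhds_basis_closedBall.eventually_iff.1
    (eventually_forall_add_mem_of_isCompact hS (hA.continuous_apply 1) isOpen_interior
      fun p hp => hpos p.1 1 one_pos p.2 hp.2.1 (Metric.ne_of_mem_sphere hp.2.2 one_ne_zero))
  refine ⟨δ, hδ, fun z v hv u hu => ?_⟩
  rcases eq_or_ne v 0 with rfl | hv0
  · rw [norm_zero, mul_zero, norm_le_zero_iff] at hu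
    rw [hu, map_zero, add_zero]
    exact hC.zero_mem
  have hnv : 0 < ‖v‖ := norm_pos_iff.2 hv0
  have hunit : A 1 z (‖v‖⁻¹ • v) + ‖v‖⁻¹ • u ∈ interior C := by
    refine hδS (x := ‖v‖⁻¹ • u) ?_ (z, ‖v‖⁻¹ • v)
      ⟨mem_univ z, hC.smul_mem v hv _, by simp [norm_smul, hv0]⟩
    rwa [mem_closedBall_zero_iff, norm_smul, norm_inv, norm_norm, inv_mul_le_iff₀ hnv, mul_comm]
  refine hC.mem_of_inv_smul_mem hnv.ne' ?_
  rw [smul_add, ← map_smul]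
  exact interior_subset hunit

/- By transversality `‖v + w‖` controls `‖w‖`, so that the margin of `A 1 z` in `C` leaves room to
amplify `w` by a fixed factor. -/
theorem exists_forall_apply_one_add_smul_mem :
    ∃ q : ℝ, 1 < q ∧ ∀ z, ∀ v ∈ C, ∀ w ∈ stableSet A C z, v + w ∈ C → A 1 z (v + q • w) ∈ C := by
  obtain ⟨c, hc, htrans⟩ := exists_mul_norm_le_norm_sub hA hpos hC
  obtain ⟨δ, hδ, hmargin⟩ := exists_forall_apply_one_add_mem hA hpos hC
  obtain ⟨L, hL, hbound⟩ := hA.exists_norm_apply_le 1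
  have hε : 0 < δ * c / L := by positivity
  refine ⟨1 + δ * c / L, by linarith, fun z v hv w hw hvw => ?_⟩
  have hw' : c * ‖w‖ ≤ ‖v + w‖ := by
    simpa using htrans z v hv _ (smul_mem_stableSet hC (-1) hw)
  rw [add_smul, one_smul, ← add_assoc, map_add, map_smul]
  refine hmargin z _ hvw _ ?_
  calc ‖(δ * c / L) • A 1 z w‖ = δ * c / L * ‖A 1 z w‖ := norm_smul_of_nonneg hε.le _
    _ ≤ δ * c / L * (L * ‖w‖) := by gcongr; exact hbound 1 (by simp) z w
    _ = δ * (c * ‖w‖) := by field_simp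
    _ ≤ δ * ‖v + w‖ := by gcongr

theorem exists_forall_apply_add_pow_smul_mem :
    ∃ q : ℝ, 1 < q ∧ ∀ (n : ℕ) (z : X), ∀ v ∈ C, ∀ w ∈ stableSet A C z, v + w ∈ C →
      A n z (v + q ^ n • w) ∈ C := by
  obtain ⟨q, hq, hstep⟩ := exists_forall_apply_one_add_smul_mem hA hpos hC
  refine ⟨q, hq, fun n z v hv w hw hvw => ?_⟩
  induction n with
  | zero => simpa [hA.map_zero_apply] using hvw
  | succ n ih =>
    rw [map_add, map_smul] at ih
    have := hstep _ _ (hpos.apply_mem hA hC n.cast_nonneg hv) _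
      (smul_mem_stableSet hC (q ^ n) (apply_mem_stableSet hA hpos hC n hw)) ih
    rwa [← map_smul, ← map_smul, ← map_add, ← hA.map_add_apply, smul_smul, ← pow_succ',
      add_comm 1, ← Nat.cast_succ] at this

theorem exists_domination_nat :
    ∃ M q : ℝ, 0 < M ∧ 1 < q ∧ ∀ (n : ℕ) (z : X), ∀ v ∈ C, ∀ w ∈ stableSet A C z,
      q ^ n * (‖A (n + 1) z w‖ * ‖v‖) ≤ M * (‖w‖ * ‖A (n + 1) z v‖) := by
  obtain ⟨c, hc, htrans⟩ := exists_mul_norm_le_norm_sub hA hpos hC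
  obtain ⟨δ, hδ, hmargin⟩ := exists_forall_apply_one_add_mem hA hpos hC
  obtain ⟨L, hL, hbound⟩ := hA.exists_norm_apply_le 1
  obtain ⟨q, hq, hgrow⟩ := exists_forall_apply_add_pow_smul_mem hA hpos hC
  have : 0 < q := one_pos.trans hq
  refine ⟨L / (c * δ), q, by positivity, hq, fun n z v hv w hw => ?_⟩
  rcases eq_or_ne w 0 with rfl | hw0
  · simp
  have : 0 < ‖w‖ := norm_pos_iff.2 hw0
  set s := δ * ‖v‖ / (L * ‖w‖) with hs
  have hs0 : 0 ≤ s := by positivity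
  have hsw := smul_mem_stableSet hC s (apply_mem_stableSet hA hpos hC 1 hw)
  have hstart : A 1 z v + s • A 1 z w ∈ C := by
    refine hmargin z v hv _ ?_
    calc ‖s • A 1 z w‖ = s * ‖A 1 z w‖ := norm_smul_of_nonneg hs0 _
      _ ≤ s * (L * ‖w‖) := by gcongr; exact hbound 1 (by simp) z w
      _ = δ * ‖v‖ := by rw [hs]; field_simp
  have hmem := hgrow n _ _ (hpos.apply_mem hA hC zero_le_one hv) _ hsw hstart
  rw [← map_smul, ← map_smul, ← map_add, ← hA.map_add_apply, map_add, map_smul, map_smul,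
    smul_smul] at hmem
  have hlow : c * ((q ^ n * s) * ‖A (n + 1) z w‖) ≤ ‖A (n + 1) z v‖ := by
    have := htrans _ _ hmem _
      (smul_mem_stableSet hC (q ^ n * s) (apply_mem_stableSet hA hpos hC (n + 1) hw))
    rwa [add_sub_cancel_right, norm_smul_of_nonneg (by positivity)] at this
  calc q ^ n * (‖A (n + 1) z w‖ * ‖v‖)
      = L / (c * δ) * (‖w‖ * (c * ((q ^ n * s) * ‖A (n + 1) z w‖))) := by rw [hs]; field_simp
    _ ≤ L / (c * δ) * (‖w‖ * ‖A (n + 1) z v‖) := by gcongr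

theorem exists_domination :
    ∃ M γ : ℝ, 0 < M ∧ 0 < γ ∧ γ < 1 ∧ ∀ z, ∀ v ∈ C, ∀ w ∈ stableSet A C z, ∀ t : ℝ, 0 ≤ t →
      ‖A t z w‖ * ‖v‖ ≤ M * γ ^ t * ‖w‖ * ‖A t z v‖ := by
  obtain ⟨M, q, hM, hq, hdom⟩ := exists_domination_nat hA hpos hC
  obtain ⟨L, hL, hbound⟩ := hA.exists_norm_apply_le 1
  have hq0 : 0 < q := one_pos.trans hq
  have hcompare (s t : ℝ) (hst : |s - t| ≤ 1) (z : X) (v : V) : ‖A s z v‖ ≤ L * ‖A t z v‖ := by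
    simpa only [← hA.map_add_apply, sub_add_cancel] using hbound (s - t) hst (Φ t z) (A t z v)
  refine ⟨L * M * q * L, q⁻¹, by positivity, by positivity, inv_lt_one_of_one_lt₀ hq,
    fun z v hv w hw t ht => ?_⟩
  obtain ⟨n, hnt, htn⟩ : ∃ n : ℕ, n ≤ t ∧ t < n + 1 :=
    ⟨⌊t⌋₊, Nat.floor_le ht, Nat.lt_floor_add_one t⟩
  have hqt : q ^ t ≤ q * q ^ n := calc
    q ^ t ≤ q ^ ((n : ℝ) + 1) := Real.rpow_le_rpow_of_exponent_le hq.le htn.le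
    _ = q * q ^ n := by rw [Real.rpow_add_one hq0.ne', Real.rpow_natCast, mul_comm]
  suffices h : q ^ t * (‖A t z w‖ * ‖v‖) ≤ L * M * q * L * (‖w‖ * ‖A t z v‖) by
    rw [Real.inv_rpow hq0.le]
    calc ‖A t z w‖ * ‖v‖ ≤ (q ^ t)⁻¹ * (L * M * q * L * (‖w‖ * ‖A t z v‖)) :=
          (le_inv_mul_iff₀ (by positivity)).2 h
      _ = L * M * q * L * (q ^ t)⁻¹ * ‖w‖ * ‖A t z v‖ := by ring
  calc q ^ t * (‖A t z w‖ * ‖v‖)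
      ≤ (q * q ^ n) * (L * ‖A (n + 1) z w‖ * ‖v‖) := by
        gcongr
        exact hcompare _ _ (abs_le.2 ⟨by linarith, by linarith⟩) z w
    _ = L * q * (q ^ n * (‖A (n + 1) z w‖ * ‖v‖)) := by ring
    _ ≤ L * q * (M * (‖w‖ * ‖A (n + 1) z v‖)) :=
        mul_le_mul_of_nonneg_left (hdom n z v hv w hw) (by positivity)
    _ ≤ L * q * (M * (‖w‖ * (L * ‖A t z v‖))) := by
        gcongr
        exact hcompare _ _ (abs_le.2 ⟨by linarith, by linarith⟩) z v
    _ = L * M * q * L * (‖w‖ * ‖A t z v‖) := by ring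

theorem eventually_norm_apply_mul_norm_le {ε : ℝ} (hε : 0 < ε) :
    ∀ᶠ t : ℝ in atTop, 0 ≤ t ∧ ∀ z, ∀ v ∈ C, ∀ w ∈ stableSet A C z,
      ‖A t z w‖ * ‖v‖ ≤ ε * ‖w‖ * ‖A t z v‖ := by
  obtain ⟨M, γ, -, hγ, hγ1, hdom⟩ := exists_domination hA hpos hC
  have hlim : Tendsto (fun t : ℝ => M * γ ^ t) atTop (𝓝 0) := by
    simpa using (tendsto_rpow_atTop_of_base_lt_one γ (by linarith) hγ1).const_mul M
  filter_upwards [hlim.eventually_lt_const hε, eventually_ge_atTop 0] with t ht ht0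
  refine ⟨ht0, fun z v hv w hw => (hdom z v hv w hw t ht0).trans ?_⟩
  gcongr

theorem isLittleO_of_mem_stableSet {v w : V} (hv : v ∈ C) (hv0 : v ≠ 0)
    (hw : w ∈ stableSet A C z) :
    (fun t => A t z w) =o[atTop] fun t => A t z v := by
  rcases eq_or_ne w 0 with rfl | hw0
  · simpa only [map_zero] using Asymptotics.isLittleO_zero _ _
  have hnv : 0 < ‖v‖ := norm_pos_iff.2 hv0
  have : 0 < ‖w‖ := norm_pos_iff.2 hw0
  refine Asymptotics.IsLittleO.of_bound fun ε hε => ?_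
  filter_upwards [eventually_norm_apply_mul_norm_le hA hpos hC (ε := ε * ‖v‖ / ‖w‖)
    (by positivity)] with t ⟨_, hdom⟩
  refine le_of_mul_le_mul_right ((hdom z v hv w hw).trans_eq ?_) hnv
  field_simp

theorem isLittleO_neg_of_mem_unstableSet {v w : V} (hv : v ∈ unstableSet A C z)
    (hw : w ∈ stableSet A C z) (hw0 : w ≠ 0) :
    (fun t => A (-t) z v) =o[atTop] fun t => A (-t) z w := by
  refine Asymptotics.IsLittleO.of_bound fun ε hε => ?_
  have hnw : 0 < ‖w‖ := norm_pos_iff.2 hw0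
  rcases eq_or_ne v 0 with rfl | hv0
  · exact Eventually.of_forall fun t => by simpa using by positivity
  have : 0 < ‖v‖ := norm_pos_iff.2 hv0
  filter_upwards [eventually_norm_apply_mul_norm_le hA hpos hC (ε := ε * ‖w‖ / ‖v‖)
    (by positivity)] with t ⟨ht, hdom⟩
  have hdom_t := hdom (Φ (-t) z) _ (hv t ht) _ (apply_mem_stableSet hA hpos hC (-t) hw)
  rw [hA.apply_neg_apply, hA.apply_neg_apply] at hdom_t
  refine le_of_mul_le_mul_left (hdom_t.trans_eq ?_) hnw
  field_simp

theorem add_mem_stableSet {w₁ w₂ : V} (hw₁ : w₁ ∈ stableSet A C z) (hw₂ : w₂ ∈ stableSet A C z) :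
    w₁ + w₂ ∈ stableSet A C z := by
  intro t _ hmem
  by_contra hne
  have hne' : A t z (w₁ + w₂) ≠ 0 := hA.apply_ne_zero t z hne
  have hself : (fun s => A s (Φ t z) (A t z (w₁ + w₂))) =o[atTop]
      fun s => A s (Φ t z) (A t z (w₁ + w₂)) := by
    simpa only [← map_add] using
      (isLittleO_of_mem_stableSet hA hpos hC hmem hne' (apply_mem_stableSet hA hpos hC t hw₁)).add
        (isLittleO_of_mem_stableSet hA hpos hC hmem hne' (apply_mem_stableSet hA hpos hC t hw₂))
  exact Asymptotics.isLittleO_irrefl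
    (Frequently.of_forall fun s => hA.apply_ne_zero s _ hne') hself

/-- The fibre at `z` of the stable bundle, as a subspace. -/
def stableSubmodule (z : X) : Submodule ℝ V where
  carrier := stableSet A C z
  add_mem' := add_mem_stableSet hA hpos hC
  zero_mem' := fun _ _ _ => rfl
  smul_mem' := fun l _ => smul_mem_stableSet hC l

theorem add_finrank_stableSubmodule (z : X) :
    k + Module.finrank ℝ (stableSubmodule hA hpos hC z) = Module.finrank ℝ V := by
  refine le_antisymm ?_ ?_
  · obtain ⟨W, hWC, rfl⟩ := hC.exists_finrank_eq
    exact Submodule.finrank_add_finrank_le_of_disjoint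
      (disjoint_of_subset_stableSet hA hWC (subset_refl (stableSet A C z)))
  -- A complement of the stable fibre is mapped into `C` after a long time.
  obtain ⟨G, hG⟩ := Submodule.exists_isCompl (stableSubmodule hA hpos hC z)
  have hS : IsCompact ((G : Set V) ∩ Metric.sphere 0 1) :=
    (isCompact_sphere 0 1).inter_left G.closed_of_finiteDimensional
  have hdisj : Disjoint ((G : Set V) ∩ Metric.sphere 0 1) (stableSet A C z) :=
    disjoint_left.2 fun u hu hus => Metric.ne_of_mem_sphere hu.2 one_ne_zero
      (Submodule.disjoint_def.1 hG.disjoint u hus hu.1)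
  obtain ⟨t, ht⟩ := (eventually_forall_apply_mem hA hpos hC hS hdisj).exists
  have hGC : (G.map (A t z : V →ₗ[ℝ] V) : Set V) ⊆ C := by
    rintro _ ⟨u, hu, rfl⟩
    rcases eq_or_ne u 0 with rfl | hu0
    · simpa using hC.zero_mem
    · refine hC.mem_of_inv_smul_mem (norm_ne_zero_iff.2 hu0) ?_
      simpa using ht (‖u‖⁻¹ • u) ⟨G.smul_mem _ hu, by simp [norm_smul, hu0]⟩
  have hGk : Module.finrank ℝ G ≤ k := hA.finrank_map t z G ▸ hC.finrank_le hGC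
  rw [← Submodule.finrank_add_eq_of_isCompl hG]
  omega

theorem exists_forall_apply_neg_mem_and_sub_mem_stableSet (T : ℝ) (hT : 0 ≤ T) (z : X) (v : V) :
    ∃ e, (∀ t ∈ Icc 0 T, A (-t) z e ∈ C) ∧ v - e ∈ stableSet A C z := by
  obtain ⟨W, hWC, hWk⟩ := hC.exists_finrank_eq
  set L := W.map (A T (Φ (-T) z) : V →ₗ[ℝ] V) with hL
  have hLC : ∀ e ∈ L, ∀ t ∈ Icc 0 T, A (-t) z e ∈ C := by
    rintro _ ⟨w, hw, rfl⟩ t ht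
    have hΦ : Φ T (Φ (-T) z) = z := by rw [← Φ.map_add, add_neg_cancel, Φ.map_zero_apply]
    have := hA.map_add_apply (-t) T (Φ (-T) z) w
    rw [hΦ] at this
    rw [ContinuousLinearMap.coe_coe, ← this]
    exact hpos.apply_mem hA hC (by linarith [ht.2]) (hWC hw)
  have hdisj : Disjoint L (stableSubmodule hA hpos hC z) :=
    disjoint_of_subset_stableSet hA
      (fun e he => by simpa [hA.map_zero_apply] using hLC e he 0 ⟨le_rfl, hT⟩)
      (subset_refl (stableSet A C z))
  have htop : L ⊔ stableSubmodule hA hpos hC z = ⊤ := by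
    refine Submodule.eq_top_of_disjoint _ _ ?_ hdisj
    rw [hL, hA.finrank_map, hWk]
    exact (add_finrank_stableSubmodule hA hpos hC z).ge
  obtain ⟨e, he, f, hf, hef⟩ := Submodule.mem_sup.1 (htop ▸ Submodule.mem_top (x := v))
  refine ⟨e, hLC e he, ?_⟩
  rw [← hef, add_sub_cancel_left]
  exact hf

theorem exists_mem_unstableSet_sub_mem_stableSet (z : X) (v : V) :
    ∃ e ∈ unstableSet A C z, v - e ∈ stableSet A C z := by
  obtain ⟨c, hc, htrans⟩ := exists_mul_norm_le_norm_sub hA hpos hC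
  let S (n : ℕ) : Set V := {e | (∀ t ∈ Icc 0 (n : ℝ), A (-t) z e ∈ C) ∧ v - e ∈ stableSet A C z}
  have hclosed (n : ℕ) : IsClosed (S n) := by
    have hstable : IsClosed {e | v - e ∈ stableSet A C z} := (isClosed_stableSet hA hpos).preimage
      (f := fun e => (z, v - e)) (by fun_prop)
    have hcone : IsClosed {e | ∀ t ∈ Icc 0 (n : ℝ), A (-t) z e ∈ C} := by
      simp only [ofPred_forall]
      exact isClosed_iInter fun t => isClosed_iInter fun _ =>
        hC.isClosed.preimage (A (-t) z).continuous
    exact hcone.inter hstable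
  have hbounded : S 0 ⊆ Metric.closedBall v (‖v‖ / c) := by
    rintro e ⟨he, hve⟩
    have heC : e ∈ C := by simpa [hA.map_zero_apply] using he 0 (by simp)
    have hle : c * ‖e - v‖ ≤ ‖v‖ := by
      simpa using htrans z e heC (e - v) (by simpa using smul_mem_stableSet hC (-1) hve)
    rw [mem_closedBall_iff_norm, le_div_iff₀ hc, mul_comm]
    exact hle
  obtain ⟨e, he⟩ := IsCompact.nonempty_iInter_of_sequence_nonempty_isCompact_isClosed S
    (fun n e he => ⟨fun t ht => he.1 t ⟨ht.1, ht.2.trans (by simp)⟩, he.2⟩)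
    (fun n => exists_forall_apply_neg_mem_and_sub_mem_stableSet hA hpos hC n n.cast_nonneg z v)
    ((isCompact_closedBall v _).of_isClosed_subset (hclosed 0) hbounded) hclosed
  rw [mem_iInter] at he
  exact ⟨e, fun t ht => (he ⌈t⌉₊).1 t ⟨ht, Nat.le_ceil t⟩, (he 0).2⟩

theorem add_mem_unstableSet {v₁ v₂ : V} (hv₁ : v₁ ∈ unstableSet A C z)
    (hv₂ : v₂ ∈ unstableSet A C z) : v₁ + v₂ ∈ unstableSet A C z := by
  obtain ⟨e, he, hf⟩ := exists_mem_unstableSet_sub_mem_stableSet hA hpos hC z (v₁ + v₂)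
  suffices v₁ + v₂ - e = 0 by rwa [sub_eq_zero.1 this]
  by_contra hne
  have hself : (fun t => A (-t) z (v₁ + v₂ - e)) =o[atTop] fun t => A (-t) z (v₁ + v₂ - e) := by
    have hsmall {v : V} (hv : v ∈ unstableSet A C z) :=
      isLittleO_neg_of_mem_unstableSet hA hpos hC hv hf hne
    simpa only [← map_add, ← map_sub] using ((hsmall hv₁).add (hsmall hv₂)).sub (hsmall he)
  exact Asymptotics.isLittleO_irrefl
    (Frequently.of_forall fun t => hA.apply_ne_zero (-t) z hne) hself

/-- The fibre at `z` of the unstable bundle, as a subspace. -/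
def unstableSubmodule (z : X) : Submodule ℝ V where
  carrier := unstableSet A C z
  add_mem' := add_mem_unstableSet hA hpos hC
  zero_mem' := fun _ _ => by simpa only [map_zero] using hC.zero_mem
  smul_mem' := fun l _ => smul_mem_unstableSet hC l

theorem isCompl_unstableSubmodule_stableSubmodule (z : X) :
    IsCompl (unstableSubmodule hA hpos hC z) (stableSubmodule hA hpos hC z) := by
  refine ⟨disjoint_of_subset_stableSet hA (unstableSet_subset hA) (subset_refl (stableSet A C z)),
    codisjoint_iff.2 (eq_top_iff.2 fun v _ => ?_)⟩
  obtain ⟨e, he, hf⟩ := exists_mem_unstableSet_sub_mem_stableSet hA hpos hC z v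
  exact Submodule.mem_sup.2 ⟨e, he, v - e, hf, add_sub_cancel e v⟩

theorem finrank_stableSubmodule (z : X) :
    Module.finrank ℝ (stableSubmodule hA hpos hC z) = Module.finrank ℝ V - k :=
  (Nat.sub_eq_of_eq_add' (add_finrank_stableSubmodule hA hpos hC z).symm).symm

theorem finrank_unstableSubmodule (z : X) :
    Module.finrank ℝ (unstableSubmodule hA hpos hC z) = k := by
  have := Submodule.finrank_add_eq_of_isCompl
    (isCompl_unstableSubmodule_stableSubmodule hA hpos hC z)
  rw [← add_finrank_stableSubmodule hA hpos hC z] at this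
  exact Nat.add_right_cancel this

theorem map_unstableSubmodule (t : ℝ) (z : X) :
    (unstableSubmodule hA hpos hC z).map (A t z : V →ₗ[ℝ] V) =
      unstableSubmodule hA hpos hC (Φ t z) := by
  refine Submodule.eq_of_le_of_finrank_eq ?_ ?_
  · rintro _ ⟨v, hv, rfl⟩
    exact apply_mem_unstableSet hA hpos hC t hv
  · rw [hA.finrank_map, finrank_unstableSubmodule, finrank_unstableSubmodule]

end StronglyPositive

end Cocycle

section Gap

variable {V : Type*} [NormedAddCommGroup V] [NormedSpace ℝ V]

theorem dist_inv_norm_smul_le {u w : V} (hu : ‖u‖ = 1) (hw : w ≠ 0) :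
    dist u (‖w‖⁻¹ • w) ≤ 2 * ‖u - w‖ := by
  have hnw : ‖w‖ ≠ 0 := norm_ne_zero_iff.2 hw
  have hscale : dist w (‖w‖⁻¹ • w) = |‖w‖ - ‖u‖| := calc
    dist w (‖w‖⁻¹ • w) = ‖(1 - ‖w‖⁻¹) • w‖ := by rw [dist_eq_norm, sub_smul, one_smul]
    _ = |(1 - ‖w‖⁻¹) * ‖w‖| := by rw [norm_smul, Real.norm_eq_abs, abs_mul, abs_norm]
    _ = |‖w‖ - ‖u‖| := by rw [sub_mul, one_mul, inv_mul_cancel₀ hnw, hu]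
  calc dist u (‖w‖⁻¹ • w) ≤ dist u w + dist w (‖w‖⁻¹ • w) := dist_triangle _ _ _
    _ ≤ ‖u - w‖ + ‖w - u‖ := by rw [hscale, dist_eq_norm]; gcongr; exact abs_norm_sub_norm_le w u
    _ = 2 * ‖u - w‖ := by rw [norm_sub_rev w u, two_mul]

theorem gap_le_of_forall_norm_sub_le {L₁ L₂ : Submodule ℝ V} [FiniteDimensional ℝ L₁]
    [FiniteDimensional ℝ L₂] (hfin : Module.finrank ℝ L₁ = Module.finrank ℝ L₂)
    (P : L₁ →ₗ[ℝ] L₂) {η : ℝ} (hη0 : 0 ≤ η) (hη : η ≤ 1 / 2)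
    (hP : ∀ u : L₁, ‖(u : V) - P u‖ ≤ η * ‖u‖) : gap L₁ L₂ ≤ 4 * η := by
  have hinj : Function.Injective P := (injective_iff_map_eq_zero P).2 fun u hu => by
    have := hP u
    rw [hu, Submodule.coe_zero, sub_zero, ← Submodule.coe_norm] at this
    exact norm_le_zero_iff.1 (by nlinarith [norm_nonneg u])
  have hsurj := (LinearMap.injective_iff_surjective_of_finrank_eq_finrank hfin).1 hinj
  refine Metric.hausdorffDist_le_of_mem_dist (by positivity) ?_ ?_
  · rintro u ⟨hu, hu1⟩
    rw [mem_sphere_zero_iff_norm] at hu1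
    have hPu : (P ⟨u, hu⟩ : V) ≠ 0 := by
      rw [Ne, Submodule.coe_eq_zero, map_eq_zero_iff P hinj, Submodule.mk_eq_zero]
      exact norm_ne_zero_iff.1 (hu1 ▸ one_ne_zero)
    refine ⟨_, ⟨L₂.smul_mem _ (P ⟨u, hu⟩).2, by simp [norm_smul, norm_ne_zero_iff.2 hPu]⟩,
      (dist_inv_norm_smul_le hu1 hPu).trans ?_⟩
    have := hP ⟨u, hu⟩
    rw [Submodule.coe_norm, hu1] at this
    linarith
  · rintro v ⟨hv, hv1⟩
    rw [mem_sphere_zero_iff_norm] at hv1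
    obtain ⟨u, hu⟩ := hsurj ⟨v, hv⟩
    have hclose : ‖(u : V) - v‖ ≤ η * ‖u‖ := by simpa only [hu] using hP u
    have hu0 : (u : V) ≠ 0 := by
      rintro h0
      rw [Submodule.coe_eq_zero] at h0
      have hv0 : v = 0 := by simpa [h0] using congrArg Subtype.val hu.symm
      simp [hv0] at hv1
    have hu2 : ‖u‖ ≤ 2 := by
      have := norm_sub_norm_le (u : V) v
      rw [hv1, ← Submodule.coe_norm] at this
      nlinarith [norm_nonneg u]
    refine ⟨_, ⟨L₁.smul_mem _ u.2, by simp [norm_smul, norm_ne_zero_iff.2 hu0]⟩,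
      (dist_inv_norm_smul_le hv1 hu0).trans ?_⟩
    rw [norm_sub_rev]
    nlinarith

variable [FiniteDimensional ℝ V]

theorem eventually_forall_norm_le_of_isClosed {X : Type*} [TopologicalSpace X]
    {Y : X → Submodule ℝ V} (hY : IsClosed {p : X × V | p.2 ∈ Y p.1}) {z : X} (T : V →L[ℝ] V)
    (hT : ∀ u ∈ Y z, T u = 0) {ε : ℝ} (hε : 0 < ε) :
    ∀ᶠ y in 𝓝 z, ∀ u ∈ Y y, ‖T u‖ ≤ ε * ‖u‖ := by
  have hsphere : ∀ᶠ y in 𝓝 z, ∀ u ∈ Metric.sphere (0 : V) 1, u ∈ Y y → ‖T u‖ < ε := by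
    refine (isCompact_sphere 0 1).eventually_forall_of_forall_eventually fun u _ => ?_
    by_cases hu : u ∈ Y z
    · have hlt : ‖T u‖ < ε := by rwa [hT u hu, norm_zero]
      have hcont : Continuous fun p : X × V => ‖T p.2‖ := (T.continuous.comp continuous_snd).norm
      exact ((hcont.tendsto (z, u)).eventually_lt_const hlt).mono fun p hp _ => hp
    · exact (hY.isOpen_compl.eventually_mem (x := (z, u)) hu).mono fun p hp hp' => absurd hp' hp
  filter_upwards [hsphere] with y hy u hu
  rcases eq_or_ne u 0 with rfl | hu0
  · simp
  have := hy (‖u‖⁻¹ • u) (by simp [norm_smul, hu0]) ((Y y).smul_mem _ hu)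
  rw [map_smul, norm_smul, norm_inv, norm_norm, inv_mul_lt_iff₀ (norm_pos_iff.2 hu0)] at this
  rw [mul_comm]
  exact this.le

theorem tendsto_gap_of_isClosed {X : Type*} [TopologicalSpace X] {Y : X → Submodule ℝ V}
    (hY : IsClosed {p : X × V | p.2 ∈ Y p.1}) {z : X}
    (hfin : ∀ y, Module.finrank ℝ (Y y) = Module.finrank ℝ (Y z)) :
    Tendsto (fun y => gap (Y y) (Y z)) (𝓝 z) (𝓝 0) := by
  obtain ⟨G, hG⟩ := Submodule.exists_isCompl (Y z)
  let P : V →ₗ[ℝ] Y z := (Y z).projectionOnto G hG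
  let T : V →L[ℝ] V := LinearMap.toContinuousLinearMap (LinearMap.id - (Y z).subtype ∘ₗ P)
  have hT : ∀ u ∈ Y z, T u = 0 := fun u hu =>
    sub_eq_zero.2 (Submodule.projection_apply_of_mem_left hG hu).symm
  refine Metric.tendsto_nhds.2 fun ε hε => ?_
  have hη : 0 < min (ε / 8) (1 / 2) := by positivity
  filter_upwards [eventually_forall_norm_le_of_isClosed hY T hT hη] with y hy
  have hgap := gap_le_of_forall_norm_sub_le (hfin y) (P ∘ₗ (Y y).subtype) hη.le (min_le_right _ _)
    fun u => hy u u.2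
  have hgap0 : 0 ≤ gap (Y y) (Y z) := Metric.hausdorffDist_nonneg
  rw [dist_zero_right, Real.norm_of_nonneg hgap0]
  linarith [min_le_left (ε / 8) (1 / 2)]

theorem isContinuousBundle_extend {d : ℕ} {K : Set V} {Y : K → Submodule ℝ V}
    (hY : IsClosed {p : K × V | p.2 ∈ Y p.1}) (hd : ∀ z, Module.finrank ℝ (Y z) = d) :
    IsContinuousBundle d K (Function.extend (↑) Y ⊥) := by
  have hext (z : K) : Function.extend (↑) Y ⊥ (z : V) = Y z :=
    Subtype.val_injective.extend_apply Y ⊥ z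
  refine ⟨fun z hz => ?_, fun z hz => ?_⟩
  · rw [hext ⟨z, hz⟩, hd]
  · rw [tendsto_nhdsWithin_iff_subtype hz, hext ⟨z, hz⟩]
    refine (tendsto_gap_of_isClosed hY (z := ⟨z, hz⟩) fun y => by rw [hd, hd]).congr fun y => ?_
    rw [domRestrict_apply, hext]

end Gap

section ExpSeparation

theorem IsLinearCocycle.restrict {X V : Type*} [TopologicalSpace X] [NormedAddCommGroup V]
    [NormedSpace ℝ V] {Φ : Flow ℝ X} {A : ℝ → X → V →L[ℝ] V} (hA : IsLinearCocycle Φ A) {K : Set X}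
    (hK : IsInvariant Φ K) : IsLinearCocycle (Φ.restrict hK) fun t (z : K) => A t z where
  continuous := hA.continuous.comp (continuous_id.prodMap continuous_subtype_val)
  map_zero_apply z := hA.map_zero_apply z
  map_add_apply s t z := hA.map_add_apply s t z

variable {V : Type*} [NormedAddCommGroup V] [NormedSpace ℝ V] {Φ : Flow ℝ V}

theorem hasStrictFDerivAt_spatialDeriv (hΦ : ContDiff ℝ 1 fun p : ℝ × V => Φ p.1 p.2) (t : ℝ)
    (z : V) : HasStrictFDerivAt (fun y => Φ t y) (spatialDeriv Φ t z) z :=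
  (hΦ.comp (contDiff_prodMk_right t)).contDiffAt.hasStrictFDerivAt one_ne_zero

theorem isLinearCocycle_spatialDeriv (hΦ : ContDiff ℝ 1 fun p : ℝ × V => Φ p.1 p.2) :
    IsLinearCocycle Φ (spatialDeriv Φ) where
  continuous := by
    have hΦ' : ContDiff ℝ 1 (Function.uncurry fun (p : ℝ × V) (y : V) => Φ p.1 y) :=
      hΦ.comp ((contDiff_fst.comp contDiff_fst).prodMk contDiff_snd)
    exact (ContDiff.fderiv (n := 0) hΦ' contDiff_snd (by norm_num)).continuous
  map_zero_apply z v := by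
    have hid : (fun y => Φ 0 y) = id := funext Φ.map_zero_apply
    rw [spatialDeriv, hid, fderiv_id, ContinuousLinearMap.id_apply]
  map_add_apply s t z v := by
    have hcomp : (fun y => Φ (s + t) y) = (fun y => Φ s y) ∘ fun y => Φ t y :=
      funext fun y => Φ.map_add s t y
    have hchain := (hasStrictFDerivAt_spatialDeriv hΦ s (Φ t z)).hasFDerivAt.comp z
      (hasStrictFDerivAt_spatialDeriv hΦ t z).hasFDerivAt
    rw [spatialDeriv, hcomp, hchain.fderiv, ContinuousLinearMap.comp_apply]

theorem exists_isExpSeparation [FiniteDimensional ℝ V] {k : ℕ} {C K : Set V}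
    (hΦ : ContDiff ℝ 1 fun p : ℝ × V => Φ p.1 p.2)
    (hpos : IsStronglyPositive (spatialDeriv Φ) C) (hC : IsCone k C) (hK : IsCompact K)
    (hinv : IsInvariant Φ K) : ∃ E F : V → Submodule ℝ V, IsExpSeparation Φ k C K E F := by
  have : CompactSpace K := isCompact_iff_compactSpace.1 hK
  have hA := (isLinearCocycle_spatialDeriv hΦ).restrict hinv
  have hposK : IsStronglyPositive (fun t (z : K) => spatialDeriv Φ t z) C := fun z => hpos z
  let E := unstableSubmodule hA hposK hC
  let F := stableSubmodule hA hposK hC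
  have hext (Y : K → Submodule ℝ V) {z : V} (hz : z ∈ K) :
      Function.extend (↑) Y ⊥ z = Y ⟨z, hz⟩ := Subtype.val_injective.extend_apply Y ⊥ ⟨z, hz⟩
  refine ⟨Function.extend (↑) E ⊥, Function.extend (↑) F ⊥,
    isContinuousBundle_extend (isClosed_unstableSet hA hC) (finrank_unstableSubmodule hA hposK hC),
    isContinuousBundle_extend (isClosed_stableSet hA hposK) (finrank_stableSubmodule hA hposK hC),
    fun z hz => ?_, fun z hz t _ => ?_, fun z hz t _ => ?_, ?_, fun z hz => ?_, fun z hz => ?_⟩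
  · rw [hext E hz, hext F hz]
    exact isCompl_unstableSubmodule_stableSubmodule hA hposK hC ⟨z, hz⟩
  · rw [hext E hz, hext E (hinv t hz)]
    exact map_unstableSubmodule hA hposK hC t ⟨z, hz⟩
  · rw [hext F hz, hext F (hinv t hz)]
    rintro _ ⟨w, hw, rfl⟩
    exact apply_mem_stableSet hA hposK hC t hw
  · obtain ⟨M, γ, hM, hγ, hγ1, hdom⟩ := exists_domination hA hposK hC
    refine ⟨M, γ, hM, hγ, hγ1, fun z hz w hw hw1 v hv hv1 t ht => ?_⟩
    rw [hext F hz] at hw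
    rw [hext E hz] at hv
    simpa only [hw1, hv1, mul_one] using hdom ⟨z, hz⟩ v (unstableSet_subset hA hv) w hw t ht
  · rw [hext E hz]
    exact unstableSet_subset_interior hA hposK (z := ⟨z, hz⟩)
  · rw [hext F hz]
    refine Subset.antisymm (fun w hw => eq_zero_of_mem_stableSet hA hw.1 hw.2) ?_
    rintro _ rfl
    exact ⟨Submodule.zero_mem _, hC.zero_mem⟩

end ExpSeparation

section Orbit

variable {V : Type*} [NormedAddCommGroup V] {Φ : Flow ℝ V} {x : V}

theorem isInvariant_omega : IsInvariant Φ (omega Φ x) :=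
  Flow.isInvariant_omegaLimit atTop Φ {x} fun t => tendsto_atTop_add_const_left _ t tendsto_id

theorem isPseudoOrdered_of_ordered {C : Set V} {s t : ℝ} (hs : 0 ≤ s) (ht : 0 ≤ t)
    (hne : Φ s x ≠ Φ t x) (hC : Ordered C (Φ s x) (Φ t x)) : IsPseudoOrdered Φ C x := by
  have hs' : Φ s x ∈ orbit Φ x := mem_image_of_mem _ hs
  have ht' : Φ t x ∈ orbit Φ x := mem_image_of_mem _ ht
  refine ⟨fun heq => hne ?_, _, hs', _, ht', hne, hC⟩
  rw [heq] at hs' ht'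
  exact hs'.trans ht'.symm

variable [ProperSpace V] (hb : Bornology.IsBounded (orbit Φ x))
include hb

theorem isCompact_omega : IsCompact (omega Φ x) := by
  refine hb.isCompact_closure.of_isClosed_subset (isClosed_omegaLimit _ _ _) ?_
  refine (omegaLimit_subset_closure_image2 _ _ _ (Ici_mem_atTop 0)).trans (closure_mono ?_)
  rw [image2_singleton_right, orbit]

theorem eventually_mem_of_omega_subset {U : Set V} (hU : IsOpen U) (hsub : omega Φ x ⊆ U) :
    ∀ᶠ t in atTop, Φ t x ∈ U := by
  have habsorb : ∀ᶠ t in atTop, MapsTo (fun y => Φ t y) {x} (closure (orbit Φ x)) :=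
    (eventually_ge_atTop 0).mono fun t ht =>
      mapsTo_singleton.2 (subset_closure (mem_image_of_mem _ ht))
  exact (eventually_mapsTo_of_isCompact_absorbing_of_isOpen_of_omegaLimit_subset atTop
    (fun t y => Φ t y) {x} hb.isCompact_closure habsorb hU hsub).mono fun _ => mapsTo_singleton.1

theorem eventually_forall_exists_dist_lt {ε : ℝ} (hε : 0 < ε) :
    ∀ᶠ y in 𝓝 x, ∀ t, 0 ≤ t → ∃ s, 0 ≤ s ∧ dist (Φ t x) (Φ s y) < ε := by
  obtain ⟨N, hNsub, hNfin, hN⟩ := Metric.finite_approx_of_totallyBounded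
    (hb.isCompact_closure.totallyBounded.subset subset_closure) (ε / 2) (half_pos hε)
  have hnear : ∀ p ∈ N, ∀ᶠ y in 𝓝 x, ∃ s, 0 ≤ s ∧ dist p (Φ s y) < ε / 2 := by
    intro p hp
    obtain ⟨s, hs, rfl⟩ := hNsub hp
    filter_upwards [(Φ.continuous_toFun s).continuousAt (Metric.ball_mem_nhds _ (half_pos hε))]
      with y hy
    exact ⟨s, hs, Metric.mem_ball'.1 hy⟩
  filter_upwards [(eventually_all_finite hNfin).2 hnear] with y hy t ht
  obtain ⟨p, hp, htp⟩ := mem_iUnion₂.1 (hN (mem_image_of_mem _ ht))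
  obtain ⟨s, hs, hps⟩ := hy p hp
  exact ⟨s, hs, (dist_triangle _ p _).trans_lt (by linarith [Metric.mem_ball.1 htp])⟩

end Orbit

section Expansion

theorem frequently_lt_of_limsup_log_div_pos {m : ℝ → ℝ} (hm : ∀ t, 0 ≤ m t)
    (hlim : 0 < limsup (fun t : ℝ => ((Real.log (m t) / t : ℝ) : EReal)) atTop) (B : ℝ) :
    ∃ᶠ t in atTop, B < m t := by
  obtain ⟨r, hr0, hr⟩ := EReal.lt_iff_exists_real_btwn.1 hlim
  rw [EReal.coe_pos] at hr0
  have hlarge : ∀ᶠ t in atTop, B < Real.exp (r * t) :=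
    (Real.tendsto_exp_atTop.comp (tendsto_id.const_mul_atTop hr0)).eventually_gt_atTop B
  refine ((frequently_lt_of_lt_limsup (by isBoundedDefault) hr).and_eventually
    (hlarge.and (eventually_gt_atTop 0))).mono fun t ⟨hrt, hBt, ht⟩ => hBt.trans ?_
  rw [EReal.coe_lt_coe_iff, lt_div_iff₀ ht] at hrt
  have hmt : m t ≠ 0 := fun h0 => by
    rw [h0, Real.log_zero] at hrt
    exact (mul_pos hr0 ht).not_gt hrt
  exact (Real.lt_log_iff_exp_lt ((hm t).lt_of_ne' hmt)).1 hrt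

theorem exists_lt_of_forall_exists_two_mul_le {g : ℝ → ℝ} {T : ℝ} (hT : 0 < g T)
    (hg : ∀ t, T ≤ t → ∃ τ, 0 < τ ∧ 2 * g t ≤ g (τ + t)) (B : ℝ) : ∃ t, T ≤ t ∧ B < g t := by
  have hpow (n : ℕ) : ∃ t, T ≤ t ∧ 2 ^ n * g T ≤ g t := by
    induction n with
    | zero => exact ⟨T, le_rfl, by rw [pow_zero, one_mul]⟩
    | succ n ih =>
      obtain ⟨t, ht, hle⟩ := ih
      obtain ⟨τ, hτ, hle'⟩ := hg t ht
      exact ⟨τ + t, by linarith, by rw [pow_succ']; linarith⟩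
  obtain ⟨n, hn⟩ := pow_unbounded_of_one_lt (B / g T) one_lt_two
  obtain ⟨t, ht, hle⟩ := hpow n
  exact ⟨t, ht, ((div_lt_iff₀ hT).1 hn).trans_le hle⟩

variable {V : Type*} [NormedAddCommGroup V] [NormedSpace ℝ V]

theorem infNorm_nonneg (T : V →L[ℝ] V) (L : Submodule ℝ V) : 0 ≤ infNorm T L :=
  Real.sInf_nonneg (forall_mem_image.2 fun _ _ => norm_nonneg _)

theorem infNorm_mul_norm_le (T : V →L[ℝ] V) {L : Submodule ℝ V} {v : V} (hv : v ∈ L) :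
    infNorm T L * ‖v‖ ≤ ‖T v‖ := by
  rcases eq_or_ne v 0 with rfl | hv0
  · simp
  have hle : infNorm T L ≤ ‖T (‖v‖⁻¹ • v)‖ :=
    csInf_le ⟨0, forall_mem_image.2 fun _ _ => norm_nonneg _⟩
      (mem_image_of_mem _ ⟨L.smul_mem _ hv, by simp [norm_smul, hv0]⟩)
  rwa [map_smul, norm_smul, norm_inv, norm_norm, ← div_eq_inv_mul,
    le_div_iff₀ (norm_pos_iff.2 hv0)] at hle

theorem exists_eventually_infNorm_mul_norm_le [FiniteDimensional ℝ V] {X : Type*}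
    [TopologicalSpace X] [CompactSpace X] {Φ : Flow ℝ X} {A : ℝ → X → V →L[ℝ] V} {k : ℕ}
    {C : Set V} (hA : IsLinearCocycle Φ A) (hpos : IsStronglyPositive A C) (hC : IsCone k C) :
    ∃ c, 0 < c ∧ ∀ᶠ t in atTop, ∀ (z : X) (E F : Submodule ℝ V), IsCompl E F → (E : Set V) ⊆ C →
      (F : Set V) ⊆ stableSet A C z → ∀ v ∈ C, infNorm (A t z) E * (c * ‖v‖) ≤ ‖A t z v‖ := by
  obtain ⟨c, hc, htrans⟩ := exists_mul_norm_le_norm_sub hA hpos hC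
  refine ⟨c / (2 * (1 + c)), by positivity, ?_⟩
  filter_upwards [eventually_norm_apply_mul_norm_le hA hpos hC (half_pos hc)]
    with t ⟨_, ht⟩ z E F hEF hE hF v hv
  obtain ⟨e, he, f, hf, rfl⟩ := Submodule.mem_sup.1
    (hEF.sup_eq_top ▸ Submodule.mem_top : v ∈ E ⊔ F)
  have hfe : c * ‖f‖ ≤ ‖e‖ := by simpa only [add_sub_cancel_right] using htrans z _ hv f (hF hf)
  have hve : c / (1 + c) * ‖e + f‖ ≤ ‖e‖ := by
    rw [div_mul_eq_mul_div, div_le_iff₀ (by positivity)]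
    nlinarith [norm_add_le e f]
  have hAfe : 2 * ‖A t z f‖ ≤ ‖A t z e‖ := by
    rcases eq_or_ne e 0 with rfl | he0
    · have hf0 : f = 0 := norm_le_zero_iff.1 (by nlinarith [norm_zero (E := V)])
      simp [hf0]
    · refine le_of_mul_le_mul_right ?_ (norm_pos_iff.2 he0)
      nlinarith [ht z e (hE he) f (hF hf), norm_nonneg (A t z e)]
  have hinf := infNorm_mul_norm_le (A t z) he
  have hAe : ‖A t z e‖ ≤ ‖A t z (e + f)‖ + ‖A t z f‖ := by
    simpa only [map_add] using norm_le_add_norm_add (A t z e) (A t z f)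
  calc infNorm (A t z) E * (c / (2 * (1 + c)) * ‖e + f‖)
      = infNorm (A t z) E * (c / (1 + c) * ‖e + f‖) / 2 := by field_simp
    _ ≤ infNorm (A t z) E * ‖e‖ / 2 := by gcongr; exact infNorm_nonneg _ _
    _ ≤ ‖A t z (e + f)‖ := by linarith

variable {Φ : Flow ℝ V} {k : ℕ} {C K : Set V} {E F : V → Submodule ℝ V}

theorem IsExpSeparation.subset_stableSet (hEF : IsExpSeparation Φ k C K E F)
    (hΦ : ContDiff ℝ 1 fun p : ℝ × V => Φ p.1 p.2) (hinv : IsInvariant Φ K) {z : V} (hz : z ∈ K) :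
    (F z : Set V) ⊆ stableSet (spatialDeriv Φ) C z := by
  have hA := isLinearCocycle_spatialDeriv hΦ
  have hFC {y w : V} (hy : y ∈ K) (hw : w ∈ F y) (hwC : w ∈ C) : w = 0 :=
    (hEF.F_inter y hy).subset ⟨hw, hwC⟩
  intro w hw t ht hwC
  rcases ht.eq_or_lt with rfl | ht
  · rw [hA.map_zero_apply] at hwC
    exact hFC hz hw hwC
  · by_contra hw0
    exact hA.apply_ne_zero t z hw0
      (hFC (hinv t hz) (hEF.map_F z hz t ht (Submodule.mem_map_of_mem hw)) hwC)

theorem IsExpSeparation.subset (hEF : IsExpSeparation Φ k C K E F) (hC : IsCone k C) {z : V}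
    (hz : z ∈ K) : (E z : Set V) ⊆ C :=
  (hEF.E_subset z hz).trans
    (union_subset interior_subset (singleton_subset_iff.2 hC.zero_mem))

variable [FiniteDimensional ℝ V] (hEF : IsExpSeparation Φ k C K E F)
  (hΦ : ContDiff ℝ 1 fun p : ℝ × V => Φ p.1 p.2) (hpos : IsStronglyPositive (spatialDeriv Φ) C)
  (hC : IsCone k C) (hK : IsCompact K) (hinv : IsInvariant Φ K)
include hEF hΦ hpos hC hK hinv

theorem IsExpSeparation.exists_forall_mul_norm_le {z : V} (hz : z ∈ K)
    (hlam : 0 < lyapunovExponent Φ E z) (B : ℝ) :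
    ∃ τ, 0 < τ ∧ ∀ v ∈ C, B * ‖v‖ ≤ ‖spatialDeriv Φ τ z v‖ := by
  have : CompactSpace K := isCompact_iff_compactSpace.1 hK
  obtain ⟨c, hc, hlow⟩ := exists_eventually_infNorm_mul_norm_le
    (A := fun t (z : K) => spatialDeriv Φ t z) (k := k)
    ((isLinearCocycle_spatialDeriv hΦ).restrict hinv) (fun z => hpos z) hC
  obtain ⟨τ, hB, hlow, hτ⟩ := ((frequently_lt_of_limsup_log_div_pos
    (fun t => infNorm_nonneg _ _) hlam (B / c)).and_eventually
      (hlow.and (eventually_gt_atTop 0))).exists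
  refine ⟨τ, hτ, fun v hv => ?_⟩
  calc B * ‖v‖ = B / c * (c * ‖v‖) := by field_simp
    _ ≤ infNorm (spatialDeriv Φ τ z) (E z) * (c * ‖v‖) := by gcongr
    _ ≤ ‖spatialDeriv Φ τ z v‖ := hlow ⟨z, hz⟩ (E z) (F z) (hEF.isCompl z hz) (hEF.subset hC hz)
      (hEF.subset_stableSet hΦ hinv hz) v hv

theorem IsExpSeparation.exists_forall_two_mul_norm_sub_le
    (hlam : ∀ z ∈ K, 0 < lyapunovExponent Φ E z) :
    ∃ δ, 0 < δ ∧ ∀ z ∈ K, ∀ a b : V, dist a z < δ → dist b z < δ → Ordered C a b →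
      ∃ τ, 0 < τ ∧ 2 * ‖a - b‖ ≤ ‖Φ τ a - Φ τ b‖ := by
  let O : Set (V × V) := {p | Ordered C p.1 p.2 →
    ∃ τ, 0 < τ ∧ 2 * ‖p.1 - p.2‖ ≤ ‖Φ τ p.1 - Φ τ p.2‖}
  have hdiag : (fun z => (z, z)) '' K ⊆ interior O := by
    rintro _ ⟨z, hz, rfl⟩
    obtain ⟨τ, hτ, hexp⟩ := hEF.exists_forall_mul_norm_le hΦ hpos hC hK hinv hz (hlam z hz) 3
    rw [mem_interior_iff_mem_nhds]
    filter_upwards [(hasStrictFDerivAt_spatialDeriv hΦ τ z).isLittleO.def one_pos] with p hp hpC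
    refine ⟨τ, hτ, ?_⟩
    linarith [hexp _ hpC,
      norm_le_norm_add_norm_sub (Φ τ p.1 - Φ τ p.2) (spatialDeriv Φ τ z (p.1 - p.2))]
  obtain ⟨δ, hδ, hsub⟩ := (hK.image (by fun_prop)).exists_thickening_subset_open
    isOpen_interior hdiag
  refine ⟨δ, hδ, fun z hz a b ha hb => interior_subset (hsub ?_ : (a, b) ∈ interior O)⟩
  exact Metric.mem_thickening_iff.2 ⟨(z, z), mem_image_of_mem _ hz, max_lt ha hb⟩

end Expansion

section OrderPreserving

variable {V : Type*} [NormedAddCommGroup V] {Φ : Flow ℝ V} {C : Set V}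

/-- The strong half of strong monotonicity: distinct ordered points are strongly ordered after any
positive time. -/
def IsStronglyOrderPreserving (Φ : Flow ℝ V) (C : Set V) : Prop :=
  ∀ x y : V, x ≠ y → Ordered C x y → ∀ t : ℝ, 0 < t → StronglyOrdered C (Φ t x) (Φ t y)

theorem IsStronglyOrderPreserving.ordered (hmono : IsStronglyOrderPreserving Φ C) {x y : V}
    (hne : x ≠ y) (hxy : Ordered C x y) {t : ℝ} (ht : 0 ≤ t) : Ordered C (Φ t x) (Φ t y) := by
  rcases ht.eq_or_lt with rfl | ht
  · simpa only [Φ.map_zero_apply] using hxy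
  · exact interior_subset (hmono x y hne hxy t ht)

theorem IsStronglyOrderPreserving.eventually_forall_sub_add_mem
    (hmono : IsStronglyOrderPreserving Φ C) (hC : IsClosed C) {R : Set V} (hR : IsCompact R)
    {δ : ℝ} (hδ : 0 < δ) {t : ℝ} (ht : 0 < t) :
    ∀ᶠ u in 𝓝 (0 : V), ∀ a ∈ R, ∀ b ∈ R, Ordered C a b → δ ≤ ‖Φ t a - Φ t b‖ →
      Φ t a - Φ t b + u ∈ interior C := by
  have := Φ.continuous_toFun t
  have hdiff : Continuous fun p : V × V => Φ t p.1 - Φ t p.2 := by fun_prop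
  have hS : IsCompact ((R ×ˢ R) ∩ ({p : V × V | p.1 - p.2 ∈ C} ∩
      {p | δ ≤ ‖Φ t p.1 - Φ t p.2‖})) :=
    (hR.prod hR).inter_right ((hC.preimage (continuous_fst.sub continuous_snd)).inter
      (isClosed_le continuous_const hdiff.norm))
  refine (eventually_forall_add_mem_of_isCompact hS hdiff isOpen_interior ?_).mono
    fun u hu a ha b hb hab hδab => hu (a, b) ⟨⟨ha, hb⟩, hab, hδab⟩
  rintro ⟨a, b⟩ ⟨-, hab, hδab⟩
  refine hmono a b ?_ hab t ht
  rintro rfl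
  exact hδ.not_ge (by simpa using hδab)

theorem IsOmegaCompact.eventually_mem_cthickening [ProperSpace V] {D : Set V}
    (hD : IsOmegaCompact Φ D) {y : V} (hy : y ∈ D) :
    ∀ᶠ t in atTop, Φ t y ∈ Metric.cthickening 1 (⋃ z ∈ D, omega Φ z) :=
  (eventually_mem_of_omega_subset (hD.1 y hy) Metric.isOpen_thickening
    ((subset_biUnion_of_mem (u := fun z => omega Φ z) hy).trans
      (Metric.self_subset_thickening one_pos _))).mono
    fun _ ht => Metric.thickening_subset_cthickening _ _ ht

theorem IsStronglyOrderPreserving.eventually_isPseudoOrdered [ProperSpace V]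
    (hmono : IsStronglyOrderPreserving Φ C) (hC : IsClosed C) {D : Set V} {x : V} (hDx : D ∈ 𝓝 x)
    (hD : IsOmegaCompact Φ D) {δ : ℝ} (hδ : 0 < δ)
    (hsep : ∀ y, y ≠ x → Ordered C y x → ∃ᶠ t in atTop, δ ≤ ‖Φ t y - Φ t x‖) :
    ∀ᶠ y in 𝓝 x, y ≠ x → Ordered C y x → IsPseudoOrdered Φ C y := by
  have hx := mem_of_mem_nhds hDx
  have hR : IsCompact (Metric.cthickening 1 (⋃ z ∈ D, omega Φ z)) :=
    Metric.isCompact_of_isClosed_isBounded Metric.isClosed_cthickening hD.2.cthickening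
  obtain ⟨κ, hκ, hmargin⟩ := Metric.eventually_nhds_iff.1
    (hmono.eventually_forall_sub_add_mem hC hR hδ one_pos)
  filter_upwards [hDx, eventually_forall_exists_dist_lt (hD.1 x hx) (lt_min hκ hδ)]
    with y hy hshadow hyx hord
  have hRpast {a : V} (ha : a ∈ D) := (tendsto_atTop_add_const_right atTop (-1 : ℝ)
    tendsto_id).eventually (hD.eventually_mem_cthickening ha)
  obtain ⟨t, hfar, hyR, hxR, ht⟩ := ((hsep y hyx hord).and_eventually
    ((hRpast hy).and ((hRpast hx).and (eventually_ge_atTop 1)))).exists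
  obtain ⟨s, hs, hclose⟩ := hshadow t (by linarith)
  rw [lt_min_iff, dist_eq_norm] at hclose
  have hflow (a : V) : Φ 1 (Φ (t + -1) a) = Φ t a := by
    rw [← Φ.map_add, add_comm t, add_neg_cancel_left]
  have hmem := hmargin (y := Φ t x - Φ s y) (by rw [dist_zero_right]; exact hclose.1)
    _ hyR _ hxR (hmono.ordered hyx hord (by simp only [id]; linarith))
  simp only [id, hflow, sub_add_sub_cancel] at hmem
  refine isPseudoOrdered_of_ordered (by linarith) hs (fun heq => ?_)
    (interior_subset (hmem hfar))
  rw [heq, norm_sub_rev] at hfar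
  linarith

end OrderPreserving

section Approximation

variable {V : Type*} [NormedAddCommGroup V] [NormedSpace ℝ V] {Φ : Flow ℝ V} {k : ℕ} {C : Set V}
  {x : V}

theorem IsCone.mem_closure_of_eventually (hC : IsCone k C) {p : V → Prop}
    (hp : ∀ᶠ y in 𝓝 x, y ≠ x → Ordered C y x → p y) : x ∈ closure {y | p y} := by
  obtain ⟨e, he, he0⟩ := hC.exists_ne_zero
  have hlim : Tendsto (fun r : ℝ => x + r • e) (𝓝[≠] 0) (𝓝 x) := by
    have hcont : Continuous fun r : ℝ => x + r • e := by fun_prop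
    simpa using (hcont.tendsto 0).mono_left nhdsWithin_le_nhds
  refine mem_closure_of_tendsto hlim ?_
  filter_upwards [hlim.eventually hp, self_mem_nhdsWithin] with r hr hr0
  refine hr (by simpa [he0] using hr0) ?_
  rw [Ordered, add_sub_cancel_left]
  exact hC.smul_mem e he r

variable [FiniteDimensional ℝ V] (hΦ : ContDiff ℝ 1 fun p : ℝ × V => Φ p.1 p.2)
  (hpos : IsStronglyPositive (spatialDeriv Φ) C) (hC : IsCone k C)
  (hmono : IsStronglyOrderPreserving Φ C)
include hΦ hpos hC hmono

theorem IsExpSeparation.exists_forall_frequently_le_norm_sub (hb : Bornology.IsBounded (orbit Φ x))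
    {E F : V → Submodule ℝ V} (hEF : IsExpSeparation Φ k C (omega Φ x) E F)
    (hlam : ∀ z ∈ omega Φ x, 0 < lyapunovExponent Φ E z) :
    ∃ δ, 0 < δ ∧ ∀ y, y ≠ x → Ordered C y x → ∃ᶠ t in atTop, δ ≤ ‖Φ t y - Φ t x‖ := by
  obtain ⟨δ, hδ, hexp⟩ := hEF.exists_forall_two_mul_norm_sub_le hΦ hpos hC (isCompact_omega hb)
    isInvariant_omega hlam
  refine ⟨δ / 2, half_pos hδ, fun y hyx hord hclose => ?_⟩
  have hnear := eventually_mem_of_omega_subset hb Metric.isOpen_thickening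
    (Metric.self_subset_thickening (half_pos hδ) (omega Φ x))
  obtain ⟨T, hT⟩ := eventually_atTop.1 ((hclose.and hnear).and (eventually_ge_atTop 0))
  have hgrow : ∀ t, T ≤ t →
      ∃ τ, 0 < τ ∧ 2 * ‖Φ t y - Φ t x‖ ≤ ‖Φ (τ + t) y - Φ (τ + t) x‖ := by
    intro t ht
    obtain ⟨⟨hyt, hxt⟩, ht0⟩ := hT t ht
    rw [not_le, ← dist_eq_norm] at hyt
    obtain ⟨z, hz, hxz⟩ := Metric.mem_thickening_iff.1 hxt
    simp only [Φ.map_add]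
    exact hexp z hz _ _ (by linarith [dist_triangle (Φ t y) (Φ t x) z]) (by linarith)
      (hmono.ordered hyx hord ht0)
  have hT0 : 0 < ‖Φ T y - Φ T x‖ := norm_sub_pos_iff.2 ((Φ.toHomeomorph T).injective.ne hyx)
  obtain ⟨t, ht, hlt⟩ := exists_lt_of_forall_exists_two_mul_le hT0 hgrow (δ / 2)
  exact (hT t ht).1.1 hlt.le

end Approximation

end ConeFlow

theorem theorem4p5_general {V : Type*} [NormedAddCommGroup V] [NormedSpace ℝ V]
    [FiniteDimensional ℝ V] {Φ : Flow ℝ V} {k : ℕ} {C D : Set V} {x : V}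
    (hΦ : ContDiff ℝ 1 fun p : ℝ × V => Φ p.1 p.2) (hC : ConeFlow.IsCone k C)
    (hmono : ConeFlow.IsStronglyOrderPreserving Φ C)
    (hpos : ConeFlow.IsStronglyPositive (ConeFlow.spatialDeriv Φ) C) (hDx : D ∈ 𝓝 x)
    (hD : ConeFlow.IsOmegaCompact Φ D) :
    (∃ E F : V → Submodule ℝ V,
      ConeFlow.IsExpSeparation Φ k C (ConeFlow.omega Φ x) E F) ∧
    ∀ E F : V → Submodule ℝ V,
      ConeFlow.IsExpSeparation Φ k C (ConeFlow.omega Φ x) E F →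
      (∀ z ∈ ConeFlow.omega Φ x, 0 < ConeFlow.lyapunovExponent Φ E z) →
      x ∈ closure (ConeFlow.pseudoOrderedSet Φ C) := by
  have hb := hD.1 x (mem_of_mem_nhds hDx)
  refine ⟨ConeFlow.exists_isExpSeparation hΦ hpos hC (ConeFlow.isCompact_omega hb)
    ConeFlow.isInvariant_omega, fun E F hEF hlam => ?_⟩
  obtain ⟨δ, hδ, hsep⟩ := hEF.exists_forall_frequently_le_norm_sub hΦ hpos hC hmono hb hlam
  exact hC.mem_closure_of_eventually
    (hmono.eventually_isPseudoOrdered hC.isClosed hDx hD hδ hsep)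

theorem theorem4p5 {V : Type*} [NormedAddCommGroup V] [NormedSpace ℝ V] [FiniteDimensional ℝ V]
    (Φ : Flow ℝ V) (α : ℝ≥0) (k : ℕ) (C : Set V) (hΦ : ConeFlow.FWW Φ α k C)
    (D : Set V) (hDopen : IsOpen D) (hD : ConeFlow.IsOmegaCompact Φ D)
    (x : V) (hx : x ∈ D) :
    (∃ E F : V → Submodule ℝ V,
      ConeFlow.IsExpSeparation Φ k C (ConeFlow.omega Φ x) E F) ∧
    ∀ E F : V → Submodule ℝ V,
      ConeFlow.IsExpSeparation Φ k C (ConeFlow.omega Φ x) E F →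
      (∀ z ∈ ConeFlow.omega Φ x, 0 < ConeFlow.lyapunovExponent Φ E z) →
      x ∈ closure (ConeFlow.pseudoOrderedSet Φ C) := by
  exact theorem4p5_general hΦ.smooth.contDiff hΦ.stronglyMonotone.isCone
    hΦ.stronglyMonotone.strong hΦ.deriv_mem (hDopen.mem_nhds hx) hD
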